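/- All node and link demands and capacities are $1$, and relaying a virtual link through a node costs $\epsilon>0$. A graph $A$ embeds into a graph $B$, written $A\mapsto B$, if the nodes of $A$ can be mapped to nodes of $B$ and every edge of $A$ to one path of $B$ joining the images of its endpoints, such that every edge of $B$ is used by at most one path and, for every node $x$ of $B$, the number of nodes mapped to $x$ plus $\epsilon$ times the number of paths that use $x$ as an inner (relay) node is at most $1$. A motif is the chain $C$ (two nodes and one edge) or a 2-connected graph, with two attachment points. A motif sequence is a list of motifs in which the second attachment point of each motif is glued to the first one of the next motif. A dictionary $D$ is a finite directed acyclic graph on a set $V_D$ of nonempty motif sequences (words) with the single root $C$, whose edges are those $(v,w)$ with $v\neq w$, $CvC\mapsto CwC$ and no other word $u$ with $CvC\mapsto CuC\mapsto CwC$ and $CuC\not\mapsto CvC$, and which is robust to composition: no $v\in V_D$ embeds into a sequence (with at most $N$ nodes, where $N$ is a given bound) that is composed of words of $\{u\in V_D: v\not\mapsto u\}$ and is not composed of words of $\{u\in V_D: v\mapsto u\}$. The set $\Gamma^+(v)$ of outgoing neighbors of $v$ is ordered by a port labeling. For $v\in V_D$ let $num\_nodes(v)$ be the number of nodes of $v$,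 let $cost(v)=\max_p\sum_{u\in p}|\Gamma^+(u)|$, the maximum being over all paths $p$ of $D$ from $C$ to $v$ (including both ends), and let $\Delta=\max_{v\in V_D} cost(v)/num\_nodes(v)$. Algorithm DICT wants to infer an unknown connected simple host graph $H$. It issues requests $G$ (simple graphs), each of which is answered by whether $G\mapsto H$. It keeps a request graph $H'$, at first a single node, and a set $\mathcal P$ of unexplored nodes, at first that node. While $\mathcal P\neq\emptyset$ it chooses any $v\in\mathcal P$ and computes $T=find\_motif\_sequence(v,\emptyset,\emptyset)$. If $T$ is empty, $v$ is removed from $\mathcal P$. Otherwise $T$ is attached to $H'$ at $v$ and, in any order, each edge of $T$ is replaced by a path with the largest possible number $j$ of edges such that the resulting graph still embeds into $H$ (found by testing $j=2,3,\dots$ until the first negative reply); all new nodes are added to $\mathcal P$. The procedure $find\_motif\_sequence(v,T_<,T_>)$ uses requests that consist of $H'$ with the sequence $T_<\,\mathrm{Bf}\,w^j\,\mathrm{Af}\,T_>$ attached at $v$, where $w\in V_D$, $j\ge 1$ and $(\mathrm{Bf},\mathrm{Af})\in\{\emptyset,C\}^2$. A pair $(w,j)$ is tested by issuing these requests for the pairs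 $(C,C),(C,\emptyset),(\emptyset,C),(\emptyset,\emptyset)$, in this order, until the first positive reply. The procedure tests $(C,1)$ and returns the empty sequence if all replies are negative. Otherwise it starts at the vertex $w=C$ of $D$ and repeatedly moves from $w$ to the first outgoing neighbor $w'$ (in port order) for which $(w',1)$ has a positive reply, until there is none. It then increases $j$ from $1$ as long as $(w,j+1)$ has a positive reply. With $(\mathrm{Bf},\mathrm{Af})$ the last pair with a positive reply, it replaces $\mathrm{Bf}$, if $\mathrm{Bf}=C$, by the result of $find\_motif\_sequence(v,T_<,w^j\,\mathrm{Af}\,T_>)$, then $\mathrm{Af}$, if $\mathrm{Af}=C$, by the result of $find\_motif\_sequence(v,T_<\,\mathrm{Bf}\,w^j,T_>)$, and returns $\mathrm{Bf}\,w^j\,\mathrm{Af}$. The request complexity of DICT on $H$ is the number of requests that it issues until it terminates, in the worst case over its arbitrary choices. Theorem. There is an absolute constant $K$ such that for every $\epsilon>0$, every bound $N$, every dictionary $D$ and every connected simple host graph $H$ with $n\ge 2$ nodes and $m$ edges, DICT with dictionary $D$ terminates on $H$, and its request complexity is finite and at most $K\,(n\cdot\Delta+m)$. -/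

import Mathlib

noncomputable section

namespace VNet

/-! ### The embedding relation -/

/-- An embedding of the guest graph `A` into the host graph `B`, where all node and link demands of
`A` and all node and link capacities of `B` are equal to one. Serving as a relay node costs `ε` per
relayed link. (`A` is meant to be finite.) -/
structure Embedding (ε : ℝ) {α β : Type*} (A : SimpleGraph α) (B : SimpleGraph β) where
  /-- the host node of every virtual node -/
  node : α → β
  /-- every virtual link is mapped to one path connecting the host nodes of its endpoints -/
  path : ∀ {a b : α}, A.Adj a b → B.Walk (node a) (node b)
  isPath : ∀ {a b : α} (h : A.Adj a b), (path h).IsPath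
  /-- links and paths are undirected -/
  path_symm : ∀ {a b : α} (h : A.Adj a b), path h.symm = (path h).reverse
  /-- node capacities: hosted virtual nodes plus `ε` times the number of relayed links -/
  node_cap : ∀ x : β,
    (({a : α | node a = x}.ncard : ℕ) : ℝ) +
      ε * (({f : Sym2 α | ∃ (a b : α) (h : A.Adj a b),
        f = s(a, b) ∧ x ∈ (path h).support ∧ x ≠ node a ∧ x ≠ node b}.ncard : ℕ) : ℝ) ≤ 1
  /-- link capacities -/
  link_cap : ∀ e ∈ B.edgeSet,
    {f : Sym2 α | ∃ (a b : α) (h : A.Adj a b), f = s(a, b) ∧ e ∈ (path h).edges}.ncard ≤ 1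

/-- The embedding relation `A ↦ B`. -/
def Embeds (ε : ℝ) {α β : Type*} (A : SimpleGraph α) (B : SimpleGraph β) : Prop :=
  Nonempty (Embedding ε A B)

/-! ### Motif sequences and request graphs -/

/-- Any two distinct nodes are joined by two internally vertex-disjoint paths. -/
def TwoConnected {α : Type*} (G : SimpleGraph α) : Prop :=
  ∀ x y : α, x ≠ y → ∃ p q : G.Walk x y, p.IsPath ∧ q.IsPath ∧ p ≠ q ∧
    ∀ z, z ∈ p.support → z ∈ q.support → z = x ∨ z = y

/-- A motif with a pair of attachment points. A motif is either the chain (two nodes, one link) or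
an at least 2-connected graph. (An attachment point on an edge of a 2-connected graph is a node of
the 2-connected graph in which this edge has been subdivided.) -/
structure Motif where
  card : ℕ
  graph : SimpleGraph (Fin card)
  isMotif : (card = 2 ∧ graph = ⊤) ∨ (3 ≤ card ∧ TwoConnected graph)
  /-- attachment point to the predecessor -/
  inn : Fin card
  /-- attachment point to the successor -/
  out : Fin card

/-- The chain `C`, with its two nodes as attachment points. -/
def chain : Motif := ⟨2, ⊤, Or.inl ⟨rfl, rfl⟩, 0, 1⟩

/-- Motif sequences: the `out` point of a motif is glued to the `inn` point of the next one. -/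
abbrev MotifSeq := List Motif

/-- A (finite) request graph, with nodes `0, …, card - 1`. -/
structure Net where
  card : ℕ
  links : Set (Sym2 ℕ)

/-- The request graph as a simple graph. -/
def Net.graph (G : Net) : SimpleGraph (Fin G.card) :=
  (SimpleGraph.fromEdgeSet G.links).comap Fin.val

/-- The names of the nodes of `M` when `M` is glued with its point `inn` to node `v` of `G`: all
nodes of `M` but `inn` are new. -/
def Net.rename (G : Net) (v : ℕ) (M : Motif) (x : Fin M.card) : ℕ :=
  if x = M.inn then v else if x < M.inn then G.card + x else G.card + x - 1

/-- Glue the motif `M` with its point `inn` to node `v` of `G`. -/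
def Net.glue (G : Net) (v : ℕ) (M : Motif) : Net where
  card := G.card + (M.card - 1)
  links := G.links ∪ Sym2.map (G.rename v M) '' M.graph.edgeSet

/-- Attach a motif sequence to node `v` of `G`. -/
def Net.attach : Net → ℕ → MotifSeq → Net
  | G, _, [] => G
  | G, v, M :: S => (G.glue v M).attach (G.rename v M M.out) S

/-- The graph with one node. -/
def Net.single : Net := ⟨1, ∅⟩

/-- The graph described by a motif sequence. -/
def seqNet (S : MotifSeq) : Net := Net.single.attach 0 S

/-- Number of nodes of a motif sequence. -/
def numNodes (S : MotifSeq) : ℕ := (seqNet S).card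

/-- The `i`-th node on a path with `j` links from `x` to `y` all of whose inner nodes are new. -/
def Net.pathNode (G : Net) (x y j i : ℕ) : ℕ :=
  if i = 0 then x else if i = j then y else G.card + (i - 1)

/-- Replace the edge `{x, y}` of `G` by a path of `j` chains. -/
def Net.subdivide (G : Net) (x y j : ℕ) : Net where
  card := G.card + (j - 1)
  links := (G.links \ {s(x, y)}) ∪
    {e | ∃ i < j, e = s(G.pathNode x y j i, G.pathNode x y j (i + 1))}

/-! ### Dictionaries -/

/-- Embedding relation between motif sequences. -/
def SeqEmbeds (ε : ℝ) (S T : MotifSeq) : Prop := Embeds ε (seqNet S).graph (seqNet T).graph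

/-- Embedding relation between motif sequences with chain context: `C S C ↦ C T C`. -/
def CtxEmbeds (ε : ℝ) (S T : MotifSeq) : Prop :=
  SeqEmbeds ε ([chain] ++ S ++ [chain]) ([chain] ++ T ++ [chain])

/-- `X⋆`: all concatenations of (zero or more) elements of `X`. -/
def star (X : Set MotifSeq) : Set MotifSeq := {S | ∃ L : List MotifSeq, (∀ w ∈ L, w ∈ X) ∧ S = L.flatten}

/-- A finite dictionary with a port labeling. Robustness to composition is required for the
compositions with at most `N` nodes (`N` being the size of the host graphs of interest). -/
structure Dictionary (ε : ℝ) (N : ℕ) where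
  /-- the vertices -/
  V : Type
  fintypeV : Fintype V
  /-- the words -/
  word : V → MotifSeq
  word_ne_nil : ∀ v, word v ≠ []
  word_injective : Function.Injective word
  /-- the outgoing neighbors of each vertex, in the order of their port labels -/
  ports : V → List V
  ports_nodup : ∀ v, (ports v).Nodup
  /-- the edges are given by the transitively reduced embedding relation with chain context -/
  mem_ports : ∀ v w, w ∈ ports v ↔
    v ≠ w ∧ CtxEmbeds ε (word v) (word w) ∧
      ¬ ∃ u, u ≠ v ∧ u ≠ w ∧ CtxEmbeds ε (word v) (word u) ∧ CtxEmbeds ε (word u) (word w) ∧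
        ¬ CtxEmbeds ε (word u) (word v)
  acyclic : ∀ v, ¬ Relation.TransGen (fun a b => b ∈ ports a) v v
  /-- the chain is the only root -/
  root : V
  word_root : word root = [chain]
  root_unique : ∀ v, (∀ u, v ∉ ports u) ↔ v = root
  /-- robustness to composition -/
  robust : ∀ v, ∀ W ∈ star {S | ∃ u, S = word u ∧ ¬ SeqEmbeds ε (word v) (word u)} \
      star {S | ∃ u, S = word u ∧ SeqEmbeds ε (word v) (word u)},
    numNodes W ≤ N → ¬ SeqEmbeds ε (word v) W

attribute [instance] Dictionary.fintypeV

namespace Dictionary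

variable {ε : ℝ} {N : ℕ}

/-- `p` is a directed path of the dictionary from the root to `v`. -/
def IsRootPath (D : Dictionary ε N) (v : D.V) (p : List D.V) : Prop :=
  p.IsChain (fun a b => b ∈ D.ports a) ∧ p.head? = some D.root ∧ p.getLast? = some v

/-- The maximum, over all paths `p` from the root to `v`, of the sum of the out-degrees of the
vertices of `p`. -/
def cost (D : Dictionary ε N) (v : D.V) : ℕ :=
  sSup {c | ∃ p, D.IsRootPath v p ∧ c = (p.map fun u => (D.ports u).length).sum}

/-- The maximum over all words `v` of `cost v / num_nodes v`. -/
def Δ (D : Dictionary ε N) : ℝ :=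
  Finset.univ.sup' ⟨D.root, Finset.mem_univ _⟩ fun v => (D.cost v : ℝ) / (numNodes (D.word v) : ℝ)

end Dictionary

/-! ### The algorithm -/

/-- Computations that issue requests: the state is the list of all requests issued so far, and
`none` means that the computation has run out of fuel, where the fuel bounds the recursion depth of the
procedures below. The fuel has no influence on a computation that does not run out of it; a
computation terminates if it does not run out of fuel for all sufficiently large amounts of it. -/
abbrev Comp (α : Type) := StateT (List Net) Option α

/-- The fuel is used up. -/
def outOfFuel {α : Type} : Comp α := fun _ => none

/-- Issue the request `G`. -/
def ask (reply : Net → Bool) (G : Net) : Comp Bool := fun log => some (reply G, log ++ [G])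

/-- The sequences denoted by the possible values of Bf and Af: `∅` or `C`. -/
def pad (b : Bool) : MotifSeq := if b then [chain] else []

/-- The pairs (Bf, Af) in decreasing order. -/
def pads : List (Bool × Bool) := [(true, true), (true, false), (false, true), (false, false)]

/-- Issue the requests with middle part `Bf S Af` for the pairs (Bf, Af) in the list until the first
positive reply. Here `req` completes a middle part to a request. -/
def tryPads (reply : Net → Bool) (req : MotifSeq → Net) (S : MotifSeq) :
    List (Bool × Bool) → Comp (Option (Bool × Bool))
  | [] => pure none
  | p :: l => do
    if ← ask reply (req (pad p.1 ++ S ++ pad p.2)) then pure (some p)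
    else tryPads reply req S l

/-- Test the words of a list of dictionary vertices until the first positive reply. -/
def tryPorts {ι : Type} (reply : Net → Bool) (req : MotifSeq → Net) (word : ι → MotifSeq) :
    List ι → Comp (Option (ι × (Bool × Bool)))
  | [] => pure none
  | w :: l => do
    match ← tryPads reply req (word w) pads with
    | some p => pure (some (w, p))
    | none => tryPorts reply req word l

/-- Follow the first outgoing edge with a positive reply as long as there is one. -/
def descend {ι : Type} (reply : Net → Bool) (req : MotifSeq → Net) (word : ι → MotifSeq)
    (ports : ι → List ι) : ℕ → ι → Bool × Bool → Comp (ι × (Bool × Bool))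
  | 0, _, _ => outOfFuel
  | fuel + 1, v, p => do
    match ← tryPorts reply req word (ports v) with
    | some (w, q) => descend reply req word ports fuel w q
    | none => pure (v, p)

/-- `S ^ j` -/
def power (S : MotifSeq) (j : ℕ) : MotifSeq := (List.replicate j S).flatten

/-- Increase the number `j` of consecutive occurrences of `S` as long as the reply is positive. -/
def grow (reply : Net → Bool) (req : MotifSeq → Net) (S : MotifSeq) :
    ℕ → ℕ → Bool × Bool → Comp (ℕ × (Bool × Bool))
  | 0, _, _ => outOfFuel
  | fuel + 1, j, p => do
    match ← tryPads reply req (power S (j + 1)) pads with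
    | some q => grow reply req S fuel (j + 1) q
    | none => pure (j, p)

/-- `find_motif_sequence (v, Tl, Tr)` for the current request graph `G`; it returns the empty
sequence if not even a chain can be embedded. -/
def findMotifSequence {ι : Type} (reply : Net → Bool) (word : ι → MotifSeq) (ports : ι → List ι)
    (root : ι) (G : Net) (v : ℕ) : ℕ → MotifSeq → MotifSeq → Comp MotifSeq
  | 0, _, _ => outOfFuel
  | fuel + 1, Tl, Tr => do
    match ← tryPads reply (fun S => G.attach v (Tl ++ S ++ Tr)) (word root) pads with
    | none => pure []
    | some p₀ => do
      let (i, p₁) ← descend reply (fun S => G.attach v (Tl ++ S ++ Tr)) word ports fuel root p₀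
      let (j, p) ← grow reply (fun S => G.attach v (Tl ++ S ++ Tr)) (word i) fuel 1 p₁
      let bf ← if p.1 then
          findMotifSequence reply word ports root G v fuel Tl (power (word i) j ++ pad p.2 ++ Tr)
        else pure []
      let af ← if p.2 then
          findMotifSequence reply word ports root G v fuel (Tl ++ bf ++ power (word i) j) Tr
        else pure []
      pure (bf ++ power (word i) j ++ af)

/-- `edge_expansion` of the edge `{x, y}` of `G`: starting from `j = 1`, increase `j` as long as the
edge can be replaced by `j + 1` chains. -/
def edgeExpansion (reply : Net → Bool) (G : Net) (x y : ℕ) : ℕ → ℕ → Comp Net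
  | 0, _ => outOfFuel
  | fuel + 1, j => do
    if ← ask reply (G.subdivide x y (j + 1)) then edgeExpansion reply G x y fuel (j + 1)
    else pure (G.subdivide x y j)

/-- Expand one after the other the edges in a list. -/
def expandAll (reply : Net → Bool) (fuel : ℕ) : Net → List (ℕ × ℕ) → Comp Net
  | G, [] => pure G
  | G, e :: l => do expandAll reply fuel (← edgeExpansion reply G e.1 e.2 fuel 1) l

/-- The arbitrary choices made by the algorithm. -/
structure Choices where
  /-- the choice of an unexplored node -/
  pick : Net → Finset ℕ → ℕ
  pick_mem : ∀ G P, P.Nonempty → pick G P ∈ P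
  /-- the order in which a (finite) set of edges is processed, and the naming of their endpoints -/
  order : Net → Set (Sym2 ℕ) → List (ℕ × ℕ)
  order_nodup : ∀ G E, E.Finite → ((order G E).map fun e => s(e.1, e.2)).Nodup
  mem_order : ∀ G E, E.Finite → ∀ e, e ∈ (order G E).map (fun e => s(e.1, e.2)) ↔ e ∈ E

/-- The main loop, with current request graph `G` and set `P` of unexplored nodes. -/
def mainLoop {ι : Type} (reply : Net → Bool) (word : ι → MotifSeq) (ports : ι → List ι) (root : ι)
    (σ : Choices) : ℕ → Net → Finset ℕ → Comp Net
  | 0, _, _ => outOfFuel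
  | fuel + 1, G, P => do
    if P.Nonempty then do
      let v := σ.pick G P
      let T ← findMotifSequence reply word ports root G v fuel [] []
      if T.isEmpty then mainLoop reply word ports root σ fuel G (P.erase v)
      else do
        let G₁ := G.attach v T
        let G₂ ← expandAll reply fuel G₁ (σ.order G₁ (G₁.links \ G.links))
        mainLoop reply word ports root σ fuel G₂ (P ∪ Finset.Ico G.card G₂.card)
    else pure G

/-- Algorithm DICT with dictionary `D`. It learns about the host graph only through `reply`. -/
def dict {ε : ℝ} {N : ℕ} (D : Dictionary ε N) (σ : Choices) (reply : Net → Bool) (fuel : ℕ) :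
    Comp Net :=
  mainLoop reply D.word D.ports D.root σ fuel Net.single {0}

open Classical in
/-- The honest binary replies of a provider with host graph `H`. -/
def provider (ε : ℝ) {V : Type*} (H : SimpleGraph V) (G : Net) : Bool :=
  decide (Embeds ε G.graph H)

/-- The number of requests issued by DICT on host graph `H` until it terminates, in the worst case
over its arbitrary choices (`⊤` if it need not terminate). All amounts of fuel for which DICT
terminates lead to the same requests, and the infimum picks their number. -/
def requestComplexity {ε : ℝ} {N : ℕ} (D : Dictionary ε N) {V : Type*} (H : SimpleGraph V) : ℕ∞ :=
  ⨆ σ : Choices, ⨅ fuel : ℕ, match (dict D σ (provider ε H) fuel).run [] with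
    | some (_, log) => (log.length : ℕ∞)
    | none => ⊤

end VNet

end

/-!
The bound is an amortized count in which every request is charged to a node or to a link of the
request graph `H'`, and `H'` cannot outgrow the host: as `ε > 0`, an embedding is injective on nodes
and sends distinct links to nonempty link-disjoint paths, so every positively answered request has at
most `n` nodes and `m` links (`Embedding.node_injective`, `Embedding.ncard_edgeSet_le`).

A call of `findMotifSequence` that ends its descent at the word `w` and grows it to `w ^ j` spends at
most `4` requests on the root, `4 * cost w` on the descent (a root path of the dictionary, on which
all ports are tested in the worst case) and `4 * j` on growing. The block `w ^ j` brings
`j * (numNodes w - 1)` new nodes, and `numNodes w ≤ 2 * (numNodes w - 1)`, so these requests amount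
to at most `8 + 8 * Δ` for each new node. The recursive calls replace a chain that is known to fit;
hence they never fail, and the estimate adds up over the recursion to `(8 + 8 * Δ) * weight T` for a
nonempty result `T` (`spec_findMotifSequence`). In an edge expansion all replies but the last one add
a node, and the last one is charged to the link of `T` that is expanded (`spec_expandAll`). A failing
call at an unexplored node costs four requests and removes this node for good. Altogether the
potential `(9 + 8 * Δ) * (n - nodes) + (m - links) + 4 * (#P + n - nodes)` pays for all requests
(`spec_mainLoop`), and `n ≤ m + 1 ≤ 2 * m` as the host is connected.

The same quantities bound the fuel: a root path of the acyclic dictionary repeats no vertex, each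
recursive call of `findMotifSequence` and each positive reply in growing or expanding adds a node to a
graph that embeds, and every round of the main loop decreases `#P + 2 * (n - nodes)`.
-/

noncomputable section

namespace VNet

/-! ### Embeddings and the size of the guest -/

namespace Embedding

variable {ε : ℝ} {α β : Type*} {A : SimpleGraph α} {B : SimpleGraph β}

theorem node_injective [Finite α] (hε : 0 < ε) (E : Embedding ε A B) :
    Function.Injective E.node := by
  intro a b hab
  by_contra hne
  have h := E.node_cap (E.node b)
  have h2 : 1 < {c : α | E.node c = E.node b}.ncard :=
    (Set.one_lt_ncard (Set.toFinite _)).2 ⟨a, hab, b, rfl, hne⟩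
  have h3 : (2 : ℝ) ≤ ({c : α | E.node c = E.node b}.ncard : ℕ) := by exact_mod_cast h2
  have h4 := mul_nonneg hε.le (Nat.cast_nonneg (α := ℝ) ({f : Sym2 α | ∃ (a' b' : α) (h : A.Adj a' b'),
        f = s(a', b') ∧ E.node b ∈ (E.path h).support ∧ E.node b ≠ E.node a' ∧
          E.node b ≠ E.node b'}.ncard))
  linarith

theorem card_le [Fintype α] [Fintype β] (hε : 0 < ε) (E : Embedding ε A B) :
    Fintype.card α ≤ Fintype.card β :=
  Fintype.card_le_of_injective _ (E.node_injective hε)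

/-- Every link occupies a link of the host, and no two links share one. -/
theorem ncard_edgeSet_le [Finite α] [Finite β] (hε : 0 < ε) (E : Embedding ε A B) :
    A.edgeSet.ncard ≤ B.edgeSet.ncard := by
  have key : ∀ f ∈ A.edgeSet, ∃ e ∈ B.edgeSet, ∃ (a b : α) (h : A.Adj a b),
      f = s(a, b) ∧ e ∈ (E.path h).edges := by
    intro f
    induction f using Sym2.ind with
    | _ a b =>
      intro hf
      have h : A.Adj a b := hf
      have hnn : (E.path h).edges ≠ [] := by
        intro h0
        exact h.ne (E.node_injective hε (SimpleGraph.Walk.edges_eq_nil.1 h0).eq)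
      obtain ⟨e, he⟩ := List.exists_mem_of_ne_nil _ hnn
      exact ⟨e, SimpleGraph.Walk.edges_subset_edgeSet _ he, a, b, h, rfl, he⟩
  have : ∃ g : Sym2 α → Sym2 β, ∀ f ∈ A.edgeSet, g f ∈ B.edgeSet ∧
      ∃ (a b : α) (h : A.Adj a b), f = s(a, b) ∧ g f ∈ (E.path h).edges := by
    classical
    -- the value off the edge set is irrelevant
    refine ⟨fun f => if h : f ∈ A.edgeSet then (key f h).choose else Sym2.map E.node f, ?_⟩
    intro f hf
    simp only [dif_pos hf]
    exact (key f hf).choose_spec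
  obtain ⟨g, hg⟩ := this
  refine Set.ncard_le_ncard_of_injOn g (fun f hf => (hg f hf).1) ?_ (Set.toFinite _)
  intro f hf f' hf' hff
  have h1 := E.link_cap (g f) (hg f hf).1
  rw [Set.ncard_le_one (Set.toFinite _)] at h1
  exact h1 f (hg f hf).2 f' (by rw [hff]; exact (hg f' hf').2)

end Embedding

/-! ### Request graphs -/

/-- All links of `G` join two distinct nodes of `G`. -/
def Net.WellFormed (G : Net) : Prop :=
  ∀ a b, s(a, b) ∈ G.links → a < G.card ∧ a ≠ b

namespace Net.WellFormed

variable {G : Net}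

theorem lt_right (hG : G.WellFormed) {a b : ℕ} (h : s(a, b) ∈ G.links) : b < G.card :=
  (hG b a (by rwa [Sym2.eq_swap])).1

theorem links_eq_image (hG : G.WellFormed) :
    G.links = Sym2.map Fin.val '' G.graph.edgeSet := by
  ext e
  induction e using Sym2.ind with
  | _ a b =>
    constructor
    · intro h
      refine ⟨s(⟨a, (hG a b h).1⟩, ⟨b, hG.lt_right h⟩), ?_, rfl⟩
      simp only [Net.graph, SimpleGraph.mem_edgeSet, SimpleGraph.comap_adj,
        SimpleGraph.fromEdgeSet_adj]
      exact ⟨h, (hG a b h).2⟩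
    · rintro ⟨f, hf, hfe⟩
      induction f using Sym2.ind with
      | _ x y =>
        simp only [Net.graph, SimpleGraph.mem_edgeSet, SimpleGraph.comap_adj,
          SimpleGraph.fromEdgeSet_adj] at hf
        rw [← hfe]
        exact hf.1

theorem finite_links (hG : G.WellFormed) : G.links.Finite := by
  rw [hG.links_eq_image]
  exact (Set.toFinite _).image _

theorem ncard_links_le (hG : G.WellFormed) : G.links.ncard ≤ G.graph.edgeSet.ncard := by
  conv_lhs => rw [hG.links_eq_image]
  exact Set.ncard_image_le (Set.toFinite _)

end Net.WellFormed

theorem Motif.two_le_card (M : Motif) : 2 ≤ M.card := by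
  rcases M.isMotif with h | h <;> omega

/-- The number of new nodes that arise when `S` is attached to a request graph. -/
def weight (S : MotifSeq) : ℕ := (S.map fun M => M.card - 1).sum

@[simp] theorem weight_nil : weight [] = 0 := rfl

@[simp] theorem weight_append (S T : MotifSeq) : weight (S ++ T) = weight S + weight T := by
  simp [weight]

theorem weight_pos {S : MotifSeq} (hS : S ≠ []) : 1 ≤ weight S := by
  cases S with
  | nil => exact absurd rfl hS
  | cons M S =>
    have := M.two_le_card
    simp only [weight, List.map_cons, List.sum_cons]
    omega

@[simp] theorem weight_power (S : MotifSeq) (j : ℕ) : weight (power S j) = j * weight S := by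
  induction j with
  | zero => simp [power]
  | succ j ih =>
    have h : power S (j + 1) = S ++ power S j := by simp [power, List.replicate_succ]
    rw [h, weight_append, ih]
    ring

theorem power_one (S : MotifSeq) : power S 1 = S := by simp [power]

theorem Net.card_attach (G : Net) (v : ℕ) (S : MotifSeq) :
    (G.attach v S).card = G.card + weight S := by
  induction S generalizing G v with
  | nil => rfl
  | cons M S ih =>
    rw [Net.attach, ih]
    simp only [Net.glue, weight, List.map_cons, List.sum_cons]
    omega

theorem numNodes_eq (S : MotifSeq) : numNodes S = 1 + weight S := Net.card_attach _ _ _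

theorem Net.links_subset_attach (G : Net) (v : ℕ) (S : MotifSeq) :
    G.links ⊆ (G.attach v S).links := by
  induction S generalizing G v with
  | nil => exact subset_rfl
  | cons M S ih => exact Set.Subset.trans Set.subset_union_left (ih (G.glue v M) _)

theorem Net.rename_lt {G : Net} {v : ℕ} (hv : v < G.card) (M : Motif) (x : Fin M.card) :
    G.rename v M x < (G.glue v M).card := by
  have h1 := x.2
  have h2 := M.inn.2
  simp only [Net.rename, Net.glue, Fin.ext_iff, Fin.lt_def]
  split_ifs <;> omega

theorem Net.rename_injective {G : Net} {v : ℕ} (hv : v < G.card) (M : Motif) :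
    Function.Injective (G.rename v M) := by
  intro x y hxy
  simp only [Net.rename, Fin.ext_iff, Fin.lt_def] at hxy
  ext
  split_ifs at hxy <;> omega

theorem Net.WellFormed.glue {G : Net} (hG : G.WellFormed) {v : ℕ} (hv : v < G.card) (M : Motif) :
    (G.glue v M).WellFormed := by
  rintro a b (h | ⟨f, hf, hfe⟩)
  · obtain ⟨h1, h2⟩ := hG a b h
    exact ⟨h1.trans_le (Nat.le_add_right _ _), h2⟩
  · induction f using Sym2.ind with
    | _ x y =>
      have hxy : x ≠ y := SimpleGraph.Adj.ne hf
      rw [Sym2.map_mk, Sym2.eq_iff] at hfe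
      rcases hfe with ⟨rfl, rfl⟩ | ⟨rfl, rfl⟩
      · exact ⟨Net.rename_lt hv M x, fun h => hxy (Net.rename_injective hv M h)⟩
      · exact ⟨Net.rename_lt hv M y, fun h => hxy (Net.rename_injective hv M h).symm⟩

theorem Net.WellFormed.attach {G : Net} (hG : G.WellFormed) {v : ℕ} (hv : v < G.card)
    (S : MotifSeq) : (G.attach v S).WellFormed := by
  induction S generalizing G v with
  | nil => exact hG
  | cons M S ih => exact ih (hG.glue hv M) (Net.rename_lt hv M M.out)

theorem Net.WellFormed.single : Net.single.WellFormed := fun _ _ h => h.elim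

/-! ### Subdividing a link -/

theorem Net.pathNode_lt {G : Net} {x y : ℕ} (hx : x < G.card) (hy : y < G.card) {i j : ℕ}
    (hij : i ≤ j) : G.pathNode x y j i < (G.subdivide x y j).card := by
  simp only [Net.pathNode, Net.subdivide]
  split_ifs <;> omega

theorem Net.pathNode_ne_succ {G : Net} {x y : ℕ} (hx : x < G.card) (hy : y < G.card)
    (hxy : x ≠ y) {i j : ℕ} (hij : i < j) : G.pathNode x y j i ≠ G.pathNode x y j (i + 1) := by
  intro h
  simp only [Net.pathNode] at h
  split_ifs at h <;> omega

theorem Net.WellFormed.subdivide {G : Net} (hG : G.WellFormed) {x y : ℕ}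
    (hxy : s(x, y) ∈ G.links) (j : ℕ) : (G.subdivide x y j).WellFormed := by
  have hx := (hG x y hxy).1
  have hne := (hG x y hxy).2
  have hy := hG.lt_right hxy
  rintro a b (⟨h, -⟩ | ⟨i, hi, h⟩)
  · obtain ⟨h1, h2⟩ := hG a b h
    exact ⟨h1.trans_le (Nat.le_add_right _ _), h2⟩
  · rw [Sym2.eq_iff] at h
    rcases h with ⟨rfl, rfl⟩ | ⟨rfl, rfl⟩
    · exact ⟨Net.pathNode_lt hx hy hi.le, Net.pathNode_ne_succ hx hy hne hi⟩
    · exact ⟨Net.pathNode_lt hx hy hi, (Net.pathNode_ne_succ hx hy hne hi).symm⟩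

theorem Net.subdivide_one {G : Net} {x y : ℕ} (hxy : s(x, y) ∈ G.links) :
    G.subdivide x y 1 = G := by
  have h : (G.links \ {s(x, y)}) ∪
      {e | ∃ i < 1, e = s(G.pathNode x y 1 i, G.pathNode x y 1 (i + 1))} = G.links := by
    ext e
    simp only [Set.mem_union, Set.mem_sdiff, Set.mem_singleton_iff, Set.mem_ofPred_eq, Nat.lt_one_iff,
      exists_eq_left, Net.pathNode]
    simp only [if_true, zero_add, one_ne_zero, if_false]
    constructor
    · rintro (h | rfl)
      · exact h.1
      · exact hxy
    · intro h
      by_cases he : e = s(x, y)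
      · exact Or.inr he
      · exact Or.inl ⟨h, he⟩
  rw [Net.subdivide, h]
  rfl

theorem Net.ncard_links_le_subdivide {G : Net} (hG : G.WellFormed) {x y : ℕ}
    (hxy : s(x, y) ∈ G.links) {j : ℕ} (hj : 1 ≤ j) :
    G.links.ncard ≤ (G.subdivide x y j).links.ncard := by
  rcases hj.eq_or_lt with rfl | hj
  · rw [Net.subdivide_one hxy]
  have hnew : s(x, G.card) ∉ G.links := fun h => (hG.lt_right h).false
  have hsub : insert s(x, G.card) (G.links \ {s(x, y)}) ⊆ (G.subdivide x y j).links := by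
    refine Set.insert_subset (Or.inr ⟨0, by omega, ?_⟩) Set.subset_union_left
    have h1 : (1 : ℕ) ≠ j := by omega
    simp [Net.pathNode, h1]
  have h := Set.ncard_le_ncard hsub (hG.subdivide hxy j).finite_links
  rw [Set.ncard_insert_of_notMem (fun h => hnew h.1) hG.finite_links.sdiff,
    Set.ncard_sdiff_singleton_of_mem hxy] at h
  omega

/-! ### Counting the requests of a computation -/

/-- From every log of earlier requests, `c` terminates without running out of fuel, and its value `a`
and the number `k` of requests that it issues satisfy `Q a k`. -/
def Spec {α : Type} (c : Comp α) (Q : α → ℕ → Prop) : Prop :=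
  ∀ log, ∃ a l, c log = some (a, log ++ l) ∧ Q a l.length

namespace Spec

variable {α β : Type}

theorem pure {a : α} {Q : α → ℕ → Prop} (h : Q a 0) : Spec (Pure.pure a : Comp α) Q :=
  fun _ => ⟨a, [], by rw [List.append_nil]; rfl, h⟩

theorem mono {c : Comp α} {P Q : α → ℕ → Prop} (hc : Spec c P) (h : ∀ a k, P a k → Q a k) :
    Spec c Q := by
  intro log
  obtain ⟨a, l, h1, h2⟩ := hc log
  exact ⟨a, l, h1, h _ _ h2⟩

theorem bind {c : Comp α} {f : α → Comp β} {P : α → ℕ → Prop} {Q : β → ℕ → Prop}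
    (hc : Spec c P) (hf : ∀ a k, P a k → Spec (f a) fun b k' => Q b (k + k')) :
    Spec (c >>= f) Q := by
  intro log
  obtain ⟨a, l, h1, h2⟩ := hc log
  obtain ⟨b, l', h3, h4⟩ := hf a _ h2 (log ++ l)
  refine ⟨b, l ++ l', ?_, by rwa [List.length_append]⟩
  change (c log >>= fun s => f s.1 s.2) = _
  rw [h1, ← List.append_assoc]
  exact h3

/-- A `do` block copies what follows a conditional into both of its branches. -/
theorem ite_bind {b : Prop} [Decidable b] {c d : Comp α} {f : α → Comp β} {Q : β → ℕ → Prop}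
    (h : Spec ((if b then c else d) >>= f) Q) : Spec (if b then c >>= f else d >>= f) Q := by
  split_ifs at h ⊢ <;> exact h

theorem ask (reply : Net → Bool) (G : Net) :
    Spec (VNet.ask reply G) fun b k => b = reply G ∧ k = 1 :=
  fun _ => ⟨reply G, [G], rfl, rfl, rfl⟩

end Spec

section Procedures

variable {reply : Net → Bool} {req : MotifSeq → Net}

theorem spec_tryPads (S : MotifSeq) (l : List (Bool × Bool)) :
    Spec (tryPads reply req S l) fun r k => k ≤ l.length ∧
      (∀ p, r = some p → reply (req (pad p.1 ++ S ++ pad p.2)) = true) ∧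
      (r = none → ∀ p ∈ l, reply (req (pad p.1 ++ S ++ pad p.2)) = false) := by
  induction l with
  | nil => exact Spec.pure (by simp)
  | cons p l ih =>
    refine (Spec.ask reply _).bind ?_
    rintro b k ⟨rfl, rfl⟩
    split_ifs with h
    · refine Spec.pure ⟨by simp, ?_, by simp⟩
      rintro q hq
      cases hq
      exact h
    · refine ih.mono ?_
      rintro r k ⟨h1, h2, h3⟩
      refine ⟨by simp only [List.length_cons]; omega, h2, fun hr q hq => ?_⟩
      rcases List.mem_cons.1 hq with rfl | hq
      · simpa using h
      · exact h3 hr q hq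

theorem spec_tryPorts {ι : Type} (word : ι → MotifSeq) (l : List ι) :
    Spec (tryPorts reply req word l) fun r k => k ≤ 4 * l.length ∧
      ∀ w p, r = some (w, p) → w ∈ l ∧ reply (req (pad p.1 ++ word w ++ pad p.2)) = true := by
  induction l with
  | nil => exact Spec.pure (by simp)
  | cons v l ih =>
    refine (spec_tryPads (word v) pads).bind ?_
    rintro (_ | p) k ⟨h1, h2, -⟩
    · refine ih.mono ?_
      rintro r k' ⟨h3, h4⟩
      refine ⟨by simp only [pads, List.length_cons, List.length_nil] at h1 ⊢; omega, ?_⟩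
      intro w q hr
      exact ⟨List.mem_cons_of_mem _ (h4 w q hr).1, (h4 w q hr).2⟩
    · refine Spec.pure ⟨by simp only [pads, List.length_cons, List.length_nil] at h1 ⊢; omega, ?_⟩
      intro w q hr
      cases hr
      exact ⟨List.mem_cons_self, h2 p rfl⟩

theorem spec_grow (S : MotifSeq) {n : ℕ}
    (hn : ∀ (j : ℕ) (p : Bool × Bool), reply (req (pad p.1 ++ power S j ++ pad p.2)) = true → j ≤ n)
    (fuel j : ℕ) (p : Bool × Bool) (hfuel : n + 1 ≤ fuel + j)
    (hp : reply (req (pad p.1 ++ power S j ++ pad p.2)) = true) :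
    Spec (grow reply req S fuel j p) fun r k => j ≤ r.1 ∧ k + 4 * j ≤ 4 * (r.1 + 1) ∧
      reply (req (pad r.2.1 ++ power S r.1 ++ pad r.2.2)) = true := by
  induction fuel generalizing j p with
  | zero => have := hn j p hp; omega
  | succ fuel ih =>
    refine (spec_tryPads (power S (j + 1)) pads).bind ?_
    rintro (_ | q) k ⟨h1, h2, -⟩ <;> simp only [pads, List.length_cons, List.length_nil] at h1
    · exact Spec.pure ⟨le_rfl, by omega, hp⟩
    · refine (ih (j + 1) q (by omega) (h2 q rfl)).mono ?_
      rintro r k' ⟨h3, h4, h5⟩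
      exact ⟨by omega, by omega, h5⟩

end Procedures

/-! ### Paths of the dictionary -/

namespace Dictionary

variable {ε : ℝ} {N : ℕ} (D : Dictionary ε N)

/-- The number of ports along a list of vertices. -/
def portSum (p : List D.V) : ℕ := (p.map fun u => (D.ports u).length).sum

variable {D}

theorem IsRootPath.nodup {v : D.V} {p : List D.V} (hp : D.IsRootPath v p) : p.Nodup := by
  have h : p.Pairwise (Relation.TransGen fun a b => b ∈ D.ports a) :=
    List.isChain_iff_pairwise.1 (hp.1.imp fun _ _ h => Relation.TransGen.single h)
  refine h.imp ?_
  rintro a b hab rfl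
  exact D.acyclic a hab

theorem isRootPath_root : D.IsRootPath D.root [D.root] :=
  ⟨List.isChain_singleton _, rfl, rfl⟩

theorem IsRootPath.concat {v w : D.V} {l : List D.V} (hp : D.IsRootPath v (l ++ [v]))
    (hw : w ∈ D.ports v) : D.IsRootPath w ((l ++ [v]) ++ [w]) := by
  refine ⟨?_, ?_, by simp⟩
  · rw [List.isChain_append]
    refine ⟨hp.1, List.isChain_singleton _, ?_⟩
    intro x hx y hy
    simp at hx hy
    subst hx hy
    exact hw
  · rw [List.head?_append, hp.2.1]
    rfl

/-- The supremum in `cost` is over a bounded set because paths have no repeated vertices. -/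
theorem IsRootPath.portSum_le_cost {v : D.V} {p : List D.V} (hp : D.IsRootPath v p) :
    D.portSum p ≤ D.cost v := by
  classical
  refine le_csSup ⟨∑ u, (D.ports u).length, ?_⟩ ⟨p, hp, rfl⟩
  rintro c ⟨q, hq, rfl⟩
  rw [← List.sum_toFinset _ hq.nodup]
  exact Finset.sum_le_sum_of_subset (Finset.subset_univ _)

variable (D)

theorem cost_le (v : D.V) : (D.cost v : ℝ) ≤ 2 * D.Δ * weight (D.word v) := by
  have h : (D.cost v : ℝ) / (numNodes (D.word v) : ℝ) ≤ D.Δ :=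
    Finset.le_sup' (fun v => (D.cost v : ℝ) / (numNodes (D.word v) : ℝ)) (Finset.mem_univ v)
  have hΔ : 0 ≤ D.Δ := le_trans (by positivity) h
  have hw : (1 : ℝ) ≤ weight (D.word v) := by exact_mod_cast weight_pos (D.word_ne_nil v)
  rw [numNodes_eq, Nat.cast_add, Nat.cast_one, div_le_iff₀ (by positivity)] at h
  nlinarith

theorem Δ_nonneg : 0 ≤ D.Δ := by
  have h : (D.cost D.root : ℝ) / (numNodes (D.word D.root) : ℝ) ≤ D.Δ :=
    Finset.le_sup' (fun v => (D.cost v : ℝ) / (numNodes (D.word v) : ℝ)) (Finset.mem_univ D.root)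
  exact le_trans (by positivity) h

end Dictionary

section Find

variable {ε : ℝ} {N : ℕ} (D : Dictionary ε N) {reply : Net → Bool}

/-- The requests are charged to the ports along the root path that the descent follows: `l` holds the
vertices that were left before the current vertex `v`. -/
theorem spec_descend {req : MotifSeq → Net} (fuel : ℕ) (v : D.V) (p : Bool × Bool) (l : List D.V)
    (hl : D.IsRootPath v (l ++ [v])) (hfuel : Fintype.card D.V ≤ fuel + l.length)
    (hp : reply (req (pad p.1 ++ D.word v ++ pad p.2)) = true) :
    Spec (descend reply req D.word D.ports fuel v p) fun r k =>
      k + 4 * D.portSum l ≤ 4 * D.cost r.1 ∧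
        reply (req (pad r.2.1 ++ D.word r.1 ++ pad r.2.2)) = true := by
  induction fuel generalizing v p l with
  | zero =>
    have h := hl.nodup.length_le_card
    simp only [List.length_append, List.length_singleton] at h
    omega
  | succ fuel ih =>
    have hs : D.portSum (l ++ [v]) = D.portSum l + (D.ports v).length := by
      simp [Dictionary.portSum]
    refine (spec_tryPorts D.word (D.ports v)).bind ?_
    rintro (_ | ⟨w, q⟩) k ⟨h1, h2⟩
    · have h3 := hl.portSum_le_cost
      exact Spec.pure ⟨by dsimp only; omega, hp⟩
    · obtain ⟨h3, h4⟩ := h2 w q rfl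
      refine (ih w q (l ++ [v]) (hl.concat h3)
        (by simp only [List.length_append, List.length_singleton]; omega) h4).mono ?_
      rintro r k' ⟨h5, h6⟩
      exact ⟨by omega, h6⟩

/-- A nonempty result has a positively answered request, which gives the size bound for the
amortization. The recursive calls are made under the hypothesis of the last clause: the pair `(∅, ∅)`
at the root reproduces the last request with a positive reply. -/
theorem spec_findMotifSequence {n : ℕ} (hcard : ∀ G, reply G = true → G.card ≤ n)
    (G : Net) (v : ℕ) (fuel : ℕ) (Tl Tr : MotifSeq)
    (hfuel : Fintype.card D.V + 2 * n + 2 ≤ fuel + weight (Tl ++ Tr))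
    (hTlr : weight (Tl ++ Tr) ≤ n) :
    Spec (findMotifSequence reply D.word D.ports D.root G v fuel Tl Tr) fun T k =>
      (T = [] → k ≤ 4) ∧
      (T ≠ [] → (k : ℝ) ≤ (8 + 8 * D.Δ) * weight T ∧
        reply (G.attach v (Tl ++ T ++ Tr)) = true) ∧
      (reply (G.attach v (Tl ++ [chain] ++ Tr)) = true → T ≠ []) := by
  induction fuel generalizing Tl Tr with
  | zero => omega
  | succ fuel ih =>
    have hw : ∀ S, reply (G.attach v (Tl ++ S ++ Tr)) = true →
        weight Tl + weight S + weight Tr ≤ n := by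
      intro S hS
      have := hcard _ hS
      rw [Net.card_attach, weight_append, weight_append] at this
      omega
    rw [weight_append] at hfuel hTlr
    refine (spec_tryPads (req := fun S => G.attach v (Tl ++ S ++ Tr)) (D.word D.root) pads).bind ?_
    rintro (_ | p₀) k₀ ⟨hk₀, hs, hnone⟩ <;>
      simp only [pads, List.length_cons, List.length_nil] at hk₀
    · refine Spec.pure ⟨fun _ => by omega, fun h => absurd rfl h, fun h => ?_⟩
      have := hnone rfl (false, false) (by simp [pads])
      simp only [D.word_root, pad, Bool.false_eq_true, if_false, List.nil_append,
        List.append_nil] at this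
      rw [this] at h
      exact absurd h (by simp)
    refine (spec_descend D fuel D.root p₀ [] D.isRootPath_root (by simp; omega) (hs p₀ rfl)).bind ?_
    rintro ⟨i, p₁⟩ k₁ ⟨hk₁, hp₁⟩
    have hi := weight_pos (D.word_ne_nil i)
    dsimp only at hk₁ hp₁ ⊢
    refine (spec_grow (req := fun S => G.attach v (Tl ++ S ++ Tr)) (D.word i) (n := n) ?_ fuel 1 p₁
      (by omega) (by rwa [power_one])).bind ?_
    · intro j p h
      have h1 := hw _ h
      simp only [weight_append, weight_power] at h1
      have h2 : j ≤ j * weight (D.word i) := Nat.le_mul_of_pos_right _ hi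
      omega
    rintro ⟨j, p⟩ k₂ ⟨hj, hk₂, hp⟩
    dsimp only at hj hk₂ hp ⊢
    have hjw : 1 ≤ weight (power (D.word i) j) := by
      rw [weight_power]; exact Nat.mul_pos hj hi
    have hcost : ((k₀ + (k₁ + k₂) : ℕ) : ℝ) ≤
        (8 + 8 * D.Δ) * weight (power (D.word i) j) := by
      have h1 : k₀ + (k₁ + k₂) ≤ 4 + 4 * D.cost i + 4 * j := by omega
      have h2 : ((k₀ + (k₁ + k₂) : ℕ) : ℝ) ≤ 4 + 4 * D.cost i + 4 * j := by exact_mod_cast h1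
      have h3 := D.cost_le i
      have h4 := D.Δ_nonneg
      have h5 : (1 : ℝ) ≤ weight (D.word i) := by exact_mod_cast hi
      have h6 : (1 : ℝ) ≤ j := by exact_mod_cast hj
      rw [weight_power, Nat.cast_mul]
      have h7 : (weight (D.word i) : ℝ) ≤ j * weight (D.word i) := by nlinarith
      have h8 : (j : ℝ) ≤ j * weight (D.word i) := by nlinarith
      have h9 : D.Δ * weight (D.word i) ≤ D.Δ * (j * weight (D.word i)) :=
        mul_le_mul_of_nonneg_left h7 h4
      nlinarith
    generalize power (D.word i) j = X at hp hjw hcost ⊢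
    have hwX := hw _ hp
    simp only [weight_append] at hwX
    have hX : X ≠ [] := by
      rintro rfl
      simp at hjw
    -- `bf` and `af` replace the paddings, each at a cost proportional to its weight
    have hbf : Spec (if p.1 then findMotifSequence reply D.word D.ports D.root G v fuel Tl
          (X ++ pad p.2 ++ Tr) else Pure.pure []) fun bf k =>
        (k : ℝ) ≤ (8 + 8 * D.Δ) * weight bf ∧
          reply (G.attach v (Tl ++ (bf ++ X ++ pad p.2) ++ Tr)) = true := by
      split_ifs with h
      · refine (ih Tl (X ++ pad p.2 ++ Tr) (by simp only [weight_append]; omega)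
          (by simp only [weight_append]; omega)).mono ?_
        rintro bf k ⟨-, h2, h3⟩
        simp only [h, pad, if_true, List.append_assoc] at hp h2 h3 ⊢
        exact h2 (h3 hp)
      · refine Spec.pure ⟨by simp, ?_⟩
        simpa [h, pad] using hp
    refine Spec.ite_bind (hbf.bind ?_)
    rintro bf k₃ ⟨hk₃, hbf⟩
    have hwb := hw _ hbf
    simp only [weight_append] at hwb
    have haf : Spec (if p.2 then findMotifSequence reply D.word D.ports D.root G v fuel
          (Tl ++ bf ++ X) Tr else Pure.pure []) fun af k =>
        (k : ℝ) ≤ (8 + 8 * D.Δ) * weight af ∧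
          reply (G.attach v (Tl ++ (bf ++ X ++ af) ++ Tr)) = true := by
      split_ifs with h
      · refine (ih (Tl ++ bf ++ X) Tr (by simp only [weight_append]; omega)
          (by simp only [weight_append]; omega)).mono ?_
        rintro af k ⟨-, h2, h3⟩
        simp only [h, pad, if_true, List.append_assoc] at hbf h2 h3 ⊢
        exact h2 (h3 hbf)
      · refine Spec.pure ⟨by simp, ?_⟩
        simpa [h, pad] using hbf
    refine Spec.ite_bind (haf.bind ?_)
    rintro af k₄ ⟨hk₄, haf⟩
    have hne : bf ++ X ++ af ≠ [] := by simp [hX]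
    refine Spec.pure ⟨fun h => absurd h hne, fun _ => ⟨?_, haf⟩, fun _ => hne⟩
    simp only [weight_append]
    push_cast at hcost ⊢
    linarith

end Find

/-! ### Edge expansion and the main loop -/

section Loop

variable {reply : Net → Bool} {n : ℕ}

theorem spec_edgeExpansion (hcard : ∀ G, reply G = true → G.card ≤ n)
    (G : Net) (x y : ℕ) (fuel j : ℕ) (hj : 1 ≤ j)
    (hfuel : n + 1 ≤ fuel + j) (hG : 1 ≤ G.card) (hr : reply (G.subdivide x y j) = true) :
    Spec (edgeExpansion reply G x y fuel j) fun G' k =>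
      ∃ j', 1 ≤ j' ∧ k + j ≤ j' + 1 ∧ G' = G.subdivide x y j' ∧ reply G' = true := by
  induction fuel generalizing j with
  | zero =>
    have := hcard _ hr
    simp only [Net.subdivide] at this
    omega
  | succ fuel ih =>
    refine (Spec.ask reply _).bind ?_
    rintro b k ⟨rfl, rfl⟩
    split_ifs with h
    · refine (ih (j + 1) (by omega) (by omega) h).mono ?_
      rintro G' k ⟨j', h1, h2, h3⟩
      exact ⟨j', h1, by omega, h3⟩
    · exact Spec.pure ⟨j, hj, by omega, rfl, hr⟩

theorem spec_expandAll (hcard : ∀ G, reply G = true → G.card ≤ n)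
    (fuel : ℕ) (hfuel : n ≤ fuel) (l : List (ℕ × ℕ)) (G : Net)
    (hG : G.WellFormed) (hG1 : 1 ≤ G.card) (hr : reply G = true)
    (hnd : (l.map fun e => s(e.1, e.2)).Nodup)
    (hl : ∀ e ∈ l, s(e.1, e.2) ∈ G.links) :
    Spec (expandAll reply fuel G l) fun G' k =>
      G'.WellFormed ∧ reply G' = true ∧ G.card ≤ G'.card ∧ G.links.ncard ≤ G'.links.ncard ∧
        k + G.card ≤ G'.card + l.length := by
  induction l generalizing G with
  | nil => exact Spec.pure ⟨hG, hr, le_rfl, le_rfl, by simp⟩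
  | cons e l ih =>
    have he := hl e List.mem_cons_self
    refine (spec_edgeExpansion hcard G e.1 e.2 fuel 1 le_rfl (by omega) hG1
      (by rwa [Net.subdivide_one he])).bind ?_
    rintro _ k ⟨j, hj, hk, rfl, hr'⟩
    rw [List.map_cons, List.nodup_cons] at hnd
    have hc : (G.subdivide e.1 e.2 j).card = G.card + (j - 1) := rfl
    refine (ih (G.subdivide e.1 e.2 j) (hG.subdivide he j) (by omega) hr' hnd.2 ?_).mono ?_
    · intro f hf
      refine Or.inl ⟨hl f (List.mem_cons_of_mem _ hf), fun h => hnd.1 ?_⟩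
      rw [← Set.mem_singleton_iff.1 h]
      exact List.mem_map_of_mem hf
    · rintro G' k' ⟨h1, h2, h3, h4, h5⟩
      have h6 := Net.ncard_links_le_subdivide hG he hj
      refine ⟨h1, h2, by omega, by omega, ?_⟩
      simp only [List.length_cons]
      omega

/-- The bound is a potential, written without subtraction: a new node pays `9 + 8 * Δ` requests for
being found or subdivided and `4` for the failing call that removes it from `P`, and a new link pays
for the negative reply that ends its expansion. -/
theorem spec_mainLoop (hcard : ∀ G, reply G = true → G.card ≤ n)
    {ε : ℝ} {N : ℕ} (D : Dictionary ε N) {m : ℕ}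
    (hlinks : ∀ G : Net, G.WellFormed → reply G = true → G.links.ncard ≤ m)
    (σ : Choices) (fuel : ℕ) (G : Net) (P : Finset ℕ)
    (hfuel : P.card + 2 * n + (Fintype.card D.V + 2 * n + 3) ≤ fuel + 2 * G.card)
    (hG : G.WellFormed) (hG1 : 1 ≤ G.card) (hGn : G.card ≤ n) (hGm : G.links.ncard ≤ m)
    (hP : ∀ v ∈ P, v < G.card) :
    Spec (mainLoop reply D.word D.ports D.root σ fuel G P) fun _ k =>
      (k : ℝ) + (13 + 8 * D.Δ) * G.card + G.links.ncard ≤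
        (13 + 8 * D.Δ) * n + m + 4 * P.card := by
  have hΔ := D.Δ_nonneg
  induction fuel generalizing G P with
  | zero => omega
  | succ fuel ih =>
    have hGn' : (G.card : ℝ) ≤ n := by exact_mod_cast hGn
    have hGm' : (G.links.ncard : ℝ) ≤ m := by exact_mod_cast hGm
    rw [mainLoop]
    split_ifs with hne
    · have hv := σ.pick_mem G P hne
      have hvG := hP _ hv
      refine (spec_findMotifSequence D hcard G (σ.pick G P) fuel [] [] (by simp; omega)
        (by simp)).bind ?_
      rintro T k ⟨hk0, hk1, -⟩
      by_cases hT : T = []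
      · have hk := hk0 hT
        subst hT
        have hc : (P.erase (σ.pick G P)).card + 1 = P.card := Finset.card_erase_add_one hv
        rw [List.isEmpty_nil, if_pos rfl]
        refine (ih G (P.erase (σ.pick G P)) (by omega) hG hG1 hGn hGm
          fun v h => hP v (Finset.mem_of_mem_erase h)).mono ?_
        rintro _ k' h
        have hc' : ((P.erase (σ.pick G P)).card : ℝ) + 1 = P.card := by exact_mod_cast hc
        have hk' : (k : ℝ) ≤ 4 := by exact_mod_cast hk
        push_cast
        linarith
      · obtain ⟨hk, hr⟩ := hk1 hT
        rw [if_neg (by simpa using hT)]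
        simp only [List.nil_append, List.append_nil] at hr
        have hTpos := weight_pos hT
        have hc1 := Net.card_attach G (σ.pick G P) T
        have hsub := Net.links_subset_attach G (σ.pick G P) T
        have hwf := hG.attach hvG T
        dsimp only
        generalize G.attach (σ.pick G P) T = G₁ at hr hc1 hsub hwf ⊢
        have hfin : (G₁.links \ G.links).Finite := hwf.finite_links.sdiff
        have hmem := σ.mem_order G₁ _ hfin
        have hnd := σ.order_nodup G₁ _ hfin
        -- the expansions end with one negative reply for each of the new links
        have hlen : (σ.order G₁ (G₁.links \ G.links)).length + G.links.ncard = G₁.links.ncard := by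
          classical
          have h1 := List.toFinset_card_of_nodup hnd
          rw [List.length_map] at h1
          rw [← h1, ← Set.ncard_coe_finset, ← Set.ncard_sdiff_add_ncard_of_subset hsub
            hwf.finite_links]
          congr 2
          ext e
          simpa using hmem e
        refine (spec_expandAll hcard fuel (by omega) _ G₁ hwf (by omega) hr hnd ?_).bind ?_
        · intro e he
          exact ((hmem _).1 (List.mem_map_of_mem he)).1
        rintro G₂ k₂ ⟨hwf₂, hr₂, hc₂, hl₂, hk₂⟩
        have hPc : (P ∪ Finset.Ico G.card G₂.card).card ≤ P.card + (G₂.card - G.card) :=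
          (Finset.card_union_le _ _).trans (by rw [Nat.card_Ico])
        refine (ih G₂ (P ∪ Finset.Ico G.card G₂.card) (by omega) hwf₂ (by omega) (hcard _ hr₂)
          (hlinks _ hwf₂ hr₂) ?_).mono ?_
        · intro u hu
          rcases Finset.mem_union.1 hu with hu | hu
          · have := hP u hu
            omega
          · exact (Finset.mem_Ico.1 hu).2
        · rintro _ k₃ h
          have e1 : ((P ∪ Finset.Ico G.card G₂.card).card : ℝ) + G.card ≤ P.card + G₂.card := by
            have : (P ∪ Finset.Ico G.card G₂.card).card + G.card ≤ P.card + G₂.card := by omega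
            exact_mod_cast this
          have e2 : (k₂ : ℝ) + G₁.card + G.links.ncard ≤ G₂.card + G₂.links.ncard := by
            have : k₂ + G₁.card + G.links.ncard ≤ G₂.card + G₂.links.ncard := by omega
            exact_mod_cast this
          have e3 : (G₁.card : ℝ) = G.card + weight T := by exact_mod_cast hc1
          have e4 : (G₁.card : ℝ) ≤ G₂.card := by exact_mod_cast hc₂
          have e5 : (8 + 8 * D.Δ) * G₁.card ≤ (8 + 8 * D.Δ) * G₂.card :=
            mul_le_mul_of_nonneg_left e4 (by positivity)
          rw [e3] at e5 e2
          push_cast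
          nlinarith
    · refine Spec.pure ?_
      have h : (13 + 8 * D.Δ) * (G.card : ℝ) ≤ (13 + 8 * D.Δ) * n :=
        mul_le_mul_of_nonneg_left hGn' (by positivity)
      have h' : (0 : ℝ) ≤ P.card := Nat.cast_nonneg _
      push_cast
      linarith

end Loop

/-! ### Host graphs -/

theorem card_le_of_provider {ε : ℝ} (hε : 0 < ε) {V : Type*} [Fintype V] {H : SimpleGraph V}
    {G : Net} (h : provider ε H G = true) : G.card ≤ Fintype.card V := by
  obtain ⟨E⟩ := @of_decide_eq_true _ (Classical.propDecidable _) h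
  simpa using E.card_le hε

theorem ncard_links_le_of_provider {ε : ℝ} (hε : 0 < ε) {V : Type*} [Finite V]
    {H : SimpleGraph V} {G : Net} (hG : G.WellFormed) (h : provider ε H G = true) :
    G.links.ncard ≤ H.edgeSet.ncard := by
  obtain ⟨E⟩ := @of_decide_eq_true _ (Classical.propDecidable _) h
  exact hG.ncard_links_le.trans (E.ncard_edgeSet_le hε)

theorem exists_requestComplexity_eq {ε : ℝ} {N : ℕ} (D : Dictionary ε N) {V : Type*}
    (H : SimpleGraph V) {B : ℝ} (hB : 0 ≤ B)
    (h : ∀ σ, ∃ fuel, Spec (dict D σ (provider ε H) fuel) fun _ k => (k : ℝ) ≤ B) :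
    ∃ t : ℕ, requestComplexity D H = t ∧ (t : ℝ) ≤ B := by
  have hle : requestComplexity D H ≤ (⌊B⌋₊ : ℕ) := by
    refine iSup_le fun σ => ?_
    obtain ⟨fuel, hf⟩ := h σ
    obtain ⟨G, l, h1, h2⟩ := hf []
    refine iInf_le_of_le fuel ?_
    rw [StateT.run, h1]
    exact Nat.cast_le.2 (Nat.le_floor h2)
  obtain ⟨t, ht⟩ := ENat.ne_top_iff_exists.1 (ne_top_of_le_ne_top (ENat.natCast_ne_top _) hle)
  refine ⟨t, ht.symm, ?_⟩
  rw [← ht] at hle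
  have : t ≤ ⌊B⌋₊ := by exact_mod_cast hle
  exact (Nat.cast_le.2 this).trans (Nat.floor_le hB)

end VNet

end

theorem theorem2 :
    ∃ K : ℝ, ∀ (ε : ℝ) (_ : 0 < ε) (N : ℕ) (D : VNet.Dictionary ε N)
      (V : Type*) [Fintype V] [Nontrivial V] (H : SimpleGraph V), H.Connected →
      ∃ t : ℕ, VNet.requestComplexity D H = t ∧
        (t : ℝ) ≤ K * ((Fintype.card V : ℝ) * D.Δ + (H.edgeSet.ncard : ℝ)) := by
  -- `13 * n + m + 4 ≤ 13 * (2 * m) + m + 4 * m = 31 * m`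
  refine ⟨31, fun ε hε N D V _ _ H hH => ?_⟩
  have hΔ := D.Δ_nonneg
  refine VNet.exists_requestComplexity_eq D H (by positivity) fun σ => ?_
  have hn : 2 ≤ Fintype.card V := Fintype.one_lt_card
  have hnm : Fintype.card V ≤ H.edgeSet.ncard + 1 := by
    have := hH.card_vert_le_card_edgeSet_add_one
    rwa [Nat.card_eq_fintype_card, Nat.card_coe_set_eq] at this
  refine ⟨1 + 2 * Fintype.card V + (Fintype.card D.V + 2 * Fintype.card V + 3),
    (VNet.spec_mainLoop (fun G => VNet.card_le_of_provider hε) D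
      (fun G => VNet.ncard_links_le_of_provider hε) σ _ VNet.Net.single {0} (by simp)
      VNet.Net.WellFormed.single le_rfl (show 1 ≤ _ by omega) (by simp [VNet.Net.single])
      (by simp [VNet.Net.single])).mono ?_⟩
  intro _ k hk
  have h1 : (2 : ℝ) ≤ Fintype.card V := by exact_mod_cast hn
  have h2 : (Fintype.card V : ℝ) ≤ H.edgeSet.ncard + 1 := by exact_mod_cast hnm
  have h3 : 0 ≤ (Fintype.card V : ℝ) * D.Δ := by positivity
  simp only [VNet.Net.single, Set.ncard_empty, Finset.card_singleton, Nat.cast_one,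
    Nat.cast_zero] at hk
  nlinarith
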